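/- Let $p$ be a prime with $p\equiv 1\pmod 4$. Then $\mathbb{Z}_p^*$ has an element of order $4$. Let $\lambda$ be any such element, let $$H=\langle a,b\mid a^2=b^2=(ab)^3=1\rangle\times\langle c\rangle\cong S_3\times\mathbb{Z}_p,$$ where $c$ has order $p$, and put $R=\{ac,ac^{-1}\}$ and $L=\{bc^{\lambda},bc^{-\lambda}\}$. Let $\mathrm{NC}_{12p}^{9}=\mathrm{BiCay}(H,R,L,\{1\})$ be the graph with vertex set $\{h_0 : h\in H\}\cup\{h_1 : h\in H\}$ (a disjoint union of two copies of $H$) whose edges are the pairs $\{h_0,g_0\}$ with $gh^{-1}\in R$, the pairs $\{h_1,g_1\}$ with $gh^{-1}\in L$, and the pairs $\{h_0,h_1\}$ with $h\in H$. Then $\mathrm{NC}_{12p}^{9}$ is a connected cubic graph of order $12p$. Its full automorphism group is transitive on its vertices but not on its arcs (ordered pairs of adjacent vertices), and it is not isomorphic to a Cayley graph of any group. Moreover $$\mathrm{Aut}(\mathrm{NC}_{12p}^{9})\cong (S_3\times\mathbb{Z}_p)\rtimes\mathbb{Z}_4,$$ where, with $S_3\times\mathbb{Z}_p$ identified with $H$,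 a generator of $\mathbb{Z}_4$ acts on $H$ as the automorphism with $a\mapsto b$, $b\mapsto a$, $c\mapsto c^{\lambda}$. -/

import Mathlib

namespace VNC

/-- The bi-Cayley graph `BiCay(H, R, L, S)`, where `R = R⁻¹`, `L = L⁻¹` and `1 ∉ R ∪ L`.
The vertex `h₀` of the right part is `Sum.inl h`, the vertex `h₁` of the left part is
`Sum.inr h`. -/
def BiCay {H : Type*} [Group H] (R L S : Set H) (hR : R⁻¹ = R) (hL : L⁻¹ = L)
    (h1 : (1 : H) ∉ R ∪ L) : SimpleGraph (H ⊕ H) where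
  Adj
    | Sum.inl h, Sum.inl g => g * h⁻¹ ∈ R
    | Sum.inr h, Sum.inr g => g * h⁻¹ ∈ L
    | Sum.inl h, Sum.inr g => g * h⁻¹ ∈ S
    | Sum.inr g, Sum.inl h => g * h⁻¹ ∈ S
  symm := ⟨by
    rintro (h | h) (g | g) hg
    · change h * g⁻¹ ∈ R
      rw [← hR]
      simpa using hg
    · exact hg
    · exact hg
    · change h * g⁻¹ ∈ L
      rw [← hL]
      simpa using hg⟩
  loopless := ⟨by
    rintro (h | h) hg
    · exact h1 (Or.inl (by simpa using hg))
    · exact h1 (Or.inr (by simpa using hg))⟩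

section Transitivity

variable {V : Type*}

/-- The full automorphism group `X ≃g X` is transitive on the vertices. -/
def IsVertexTransitive (X : SimpleGraph V) : Prop :=
  ∀ u v : V, ∃ f : X ≃g X, f u = v

/-- The full automorphism group is transitive on the arcs, the ordered pairs of adjacent
vertices. Arc-transitive graphs are also called symmetric. -/
def IsArcTransitive (X : SimpleGraph V) : Prop :=
  ∀ u v u' v' : V, X.Adj u v → X.Adj u' v' → ∃ f : X ≃g X, f u = u' ∧ f v = v'

/-- Every vertex has exactly three neighbours. -/
def IsCubic (X : SimpleGraph V) : Prop :=
  ∀ v : V, (X.neighborSet v).ncard = 3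

end Transitivity

/-- `X` is isomorphic to the Cayley graph of a group `G` with respect to a subset `S = S⁻¹` not
containing `1`. In `SimpleGraph.mulCayley S` the edges are the pairs `{g, g s}` with `s ∈ S`;
inversion in `G` is an isomorphism with the graph whose edges are the pairs `{g, s g}`.
The group is in bijection with `V`, so groups in the universe of `V` suffice. -/
def IsCayley.{u} {V : Type u} (X : SimpleGraph V) : Prop :=
  ∃ (G : Type u) (_ : Group G) (S : Set G),
    S⁻¹ = S ∧ (1 : G) ∉ S ∧ Nonempty (X ≃g SimpleGraph.mulCayley S)

/-- A vertex-transitive non-Cayley graph. -/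
def IsVNC {V : Type*} (X : SimpleGraph V) : Prop :=
  IsVertexTransitive X ∧ ¬ IsCayley X

/-- The group `H = S₃ × ℤ_p`, written multiplicatively. -/
abbrev GroupH (p : ℕ) : Type := Equiv.Perm (Fin 3) × Multiplicative (ZMod p)

/-- The involution `a` of the factor `S₃` of `H`. -/
def genA (p : ℕ) : GroupH p := (Equiv.swap 0 1, 1)

/-- The involution `b` of the factor `S₃` of `H`. -/
def genB (p : ℕ) : GroupH p := (Equiv.swap 1 2, 1)

/-- The generator `c` of the factor `ℤ_p` of `H`. -/
def genC (p : ℕ) : GroupH p := (1, Multiplicative.ofAdd 1)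

/-- The involutions `a` and `b` satisfy the defining relations of `S₃`. -/
theorem gen_relations (p : ℕ) :
    genA p ^ 2 = 1 ∧ genB p ^ 2 = 1 ∧ (genA p * genB p) ^ 3 = 1 := by
  refine ⟨?_, ?_, ?_⟩ <;> refine Prod.ext ?_ (by simp [genA, genB]) <;>
    simp only [genA, genB, Prod.pow_fst, Prod.mk_mul_mk, Prod.fst_one] <;> decide

/-- The transpositions `(0 1)` and `(1 2)`, which are the first components of `a` and `b`,
generate `S₃`. -/
theorem gen_closure :
    Subgroup.closure {Equiv.swap (0 : Fin 3) 1, Equiv.swap (1 : Fin 3) 2} = ⊤ := by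
  rw [eq_top_iff]
  intro x _
  have ha : Equiv.swap (0 : Fin 3) 1 ∈
      Subgroup.closure {Equiv.swap (0 : Fin 3) 1, Equiv.swap (1 : Fin 3) 2} :=
    Subgroup.subset_closure (by simp)
  have hb : Equiv.swap (1 : Fin 3) 2 ∈
      Subgroup.closure {Equiv.swap (0 : Fin 3) 1, Equiv.swap (1 : Fin 3) 2} :=
    Subgroup.subset_closure (by simp)
  have key : ∀ x : Equiv.Perm (Fin 3), x = 1 ∨ x = Equiv.swap 0 1 ∨ x = Equiv.swap 1 2 ∨
      x = Equiv.swap 0 1 * Equiv.swap 1 2 ∨ x = Equiv.swap 1 2 * Equiv.swap 0 1 ∨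
      x = Equiv.swap 0 1 * Equiv.swap 1 2 * Equiv.swap 0 1 := by decide
  rcases key x with h | h | h | h | h | h <;> rw [h]
  · exact one_mem _
  · exact ha
  · exact hb
  · exact mul_mem ha hb
  · exact mul_mem hb ha
  · exact mul_mem (mul_mem ha hb) ha

/-- The power `c ^ l`, where the exponent is a residue class modulo `p`. -/
def powC {p : ℕ} (l : (ZMod p)ˣ) : GroupH p := genC p ^ (l : ZMod p).val

/-- `R = {a c, a c⁻¹}`. -/
def setR (p : ℕ) : Set (GroupH p) := {genA p * genC p, genA p * (genC p)⁻¹}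

/-- `L = {b c ^ l, b c ^ (-l)}`. -/
def setL {p : ℕ} (l : (ZMod p)ˣ) : Set (GroupH p) := {genB p * powC l, genB p * (powC l)⁻¹}

theorem pair_inv {G : Type*} [Group G] {x y : G} (hx : x * x = 1) (hxy : x * y = y * x) :
    ({x * y, x * y⁻¹} : Set G)⁻¹ = {x * y, x * y⁻¹} := by
  have hx' : x⁻¹ = x := inv_eq_of_mul_eq_one_left hx
  have hc : Commute x y := hxy
  have e1 : (x * y)⁻¹ = x * y⁻¹ := by rw [mul_inv_rev, hx', hc.inv_right.eq]
  have e2 : (x * y⁻¹)⁻¹ = x * y := by rw [← e1, inv_inv]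
  rw [Set.inv_insert, Set.inv_singleton, e1, e2, Set.pair_comm]

theorem powC_fst {p : ℕ} (l : (ZMod p)ˣ) : (powC l).1 = 1 := by simp [powC, genC]

theorem setR_inv (p : ℕ) : (setR p)⁻¹ = setR p :=
  pair_inv (by rw [← pow_two]; exact (gen_relations p).1)
    (Prod.ext (by simp [genA, genC]) (mul_comm _ _))

theorem setL_inv {p : ℕ} (l : (ZMod p)ˣ) : (setL l)⁻¹ = setL l :=
  pair_inv (by rw [← pow_two]; exact (gen_relations p).2.1)
    (Prod.ext (by simp [powC_fst]) (mul_comm _ _))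

theorem one_notMem {p : ℕ} (l : (ZMod p)ˣ) : (1 : GroupH p) ∉ setR p ∪ setL l := by
  have ha : (1 : Equiv.Perm (Fin 3)) ≠ Equiv.swap 0 1 := by decide
  have hb : (1 : Equiv.Perm (Fin 3)) ≠ Equiv.swap 1 2 := by decide
  rintro ((h | h) | (h | h))
  · exact ha (by simpa [genA, genC] using congrArg Prod.fst h)
  · exact ha (by simpa [genA, genC] using congrArg Prod.fst h)
  · exact hb (by simpa [genB, powC_fst] using congrArg Prod.fst h)
  · exact hb (by simpa [genB, powC_fst] using congrArg Prod.fst h)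

/-- The one-matching bi-Cayley graph `NC_{12p}^9 = BiCay(H, R, L, {1})`, for an element `l` of
`ℤ_p^*` (of order `4` in all uses). -/
def NC9 {p : ℕ} (l : (ZMod p)ˣ) : SimpleGraph (GroupH p ⊕ GroupH p) :=
  BiCay (setR p) (setL l) {1} (setR_inv p) (setL_inv l) (one_notMem l)

end VNC

namespace VNC

open Equiv Multiplicative

variable {p : ℕ}

/-! Right multiplication by `H` has the two copies of `H` as its orbits. The automorphism a ↔ b, c ↦
c^λ carries R to L and, because λ² = -1, also L to R; combined with an exchange of the copies it
gives `twist`, of order 4. Hence the graph is vertex-transitive, and it remains to show that a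
vertex stabilizer has only two elements.

The key is that automorphisms preserve the spokes, the edges {h₀, h₁} (`map_move_spoke`). Consider
the closed walks of ten steps from the base vertex that never backtrack between consecutive steps.
The exponent of c along a walk is a + bλ, so the walks can be followed in a lift that records the
Gaussian integer a + bi. In the lift, 8 of them start along the spoke and 6 along either other edge.
A further walk closes modulo p only if p divides the nonzero norm a² + b², whose only possible prime
divisors at this length are 2, 3 and 5. For p = 5 the counts are 24 and 22.

Spokes being preserved, the graph is not arc-transitive. Without spokes it is a union of 2p-cycles,
and an automorphism that fixes two consecutive vertices of one cycle fixes everything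
(`eq_one_of_map_eq`). So the stabilizer of the base vertex is {1, `twist`²}, and `rightMul` and
`twist` give all automorphisms. A regular subgroup would contain `twist` or its inverse, hence the
nontrivial `twist`² with its fixed points, which is impossible. -/

/-- The three directions in which a vertex of `NC9` can be left. -/
inductive Step
  | spoke
  | plus
  | minus

/-- The direction opposite to a given one. -/
def Step.op : Step → Step
  | spoke => spoke
  | plus => minus
  | minus => plus

/-! ### Moves along edges and shifts by powers of c -/

/-- The neighbour of a vertex in a given direction. -/
def move (l : ZMod p) : Step → GroupH p ⊕ GroupH p → GroupH p ⊕ GroupH p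
  | .spoke, Sum.inl h => Sum.inr h
  | .spoke, Sum.inr h => Sum.inl h
  | .plus, Sum.inl h => Sum.inl (swap 0 1 * h.1, ofAdd 1 * h.2)
  | .plus, Sum.inr h => Sum.inr (swap 1 2 * h.1, ofAdd l * h.2)
  | .minus, Sum.inl h => Sum.inl (swap 0 1 * h.1, ofAdd (-1) * h.2)
  | .minus, Sum.inr h => Sum.inr (swap 1 2 * h.1, ofAdd (-l) * h.2)

/-- Multiplication by the central element `c ^ x` on both copies of `H`. -/
def shift (x : ZMod p) : GroupH p ⊕ GroupH p → GroupH p ⊕ GroupH p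
  | Sum.inl h => Sum.inl (h.1, ofAdd x * h.2)
  | Sum.inr h => Sum.inr (h.1, ofAdd x * h.2)

/-- The difference of the exponents of `c` along the edges within the copy of a vertex. -/
def stride (l : ZMod p) : GroupH p ⊕ GroupH p → ZMod p
  | Sum.inl _ => 1
  | Sum.inr _ => l

theorem move_op_move (l : ZMod p) (d : Step) (v : GroupH p ⊕ GroupH p) :
    move l d.op (move l d v) = v := by
  rcases v with ⟨σ, x⟩ | ⟨σ, x⟩ <;> cases d <;>
    simp [move, Step.op]

theorem move_shift (l x : ZMod p) (d : Step) (v : GroupH p ⊕ GroupH p) :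
    move l d (shift x v) = shift x (move l d v) := by
  rcases v with ⟨σ, y⟩ | ⟨σ, y⟩ <;> cases d <;> simp [move, shift, mul_left_comm]

theorem shift_shift (x y : ZMod p) (v : GroupH p ⊕ GroupH p) :
    shift x (shift y v) = shift (x + y) v := by
  rcases v with ⟨σ, z⟩ | ⟨σ, z⟩ <;> simp [shift, mul_assoc]

theorem shift_zero (v : GroupH p ⊕ GroupH p) : shift 0 v = v := by
  rcases v with ⟨σ, z⟩ | ⟨σ, z⟩ <;> simp [shift]

theorem shift_injective (v : GroupH p ⊕ GroupH p) :
    Function.Injective fun x : ZMod p => shift x v := by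
  intro x y h
  rcases v with ⟨σ, z⟩ | ⟨σ, z⟩ <;> simpa [shift] using h

theorem stride_shift (l x : ZMod p) (v : GroupH p ⊕ GroupH p) :
    stride l (shift x v) = stride l v := by
  rcases v with v | v <;> rfl

/-- The involutions a and b cancel, so two equal steps within a copy amount to a central
translation. -/
theorem move_plus_plus (l : ZMod p) (v : GroupH p ⊕ GroupH p) :
    move l .plus (move l .plus v) = shift (2 * stride l v) v := by
  rcases v with ⟨σ, x⟩ | ⟨σ, x⟩ <;>
    simp only [move, shift, stride, two_mul, ofAdd_add, mul_assoc, swap_mul_self_mul]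

theorem move_minus (l : ZMod p) (v : GroupH p ⊕ GroupH p) :
    move l .minus v = shift (-(2 * stride l v)) (move l .plus v) := by
  rcases v with ⟨σ, x⟩ | ⟨σ, x⟩ <;>
    simp only [move, shift, stride, ← mul_assoc, ← ofAdd_add] <;> congr <;> ring

theorem move_spoke_ne (l x : ZMod p) (v : GroupH p ⊕ GroupH p) :
    move l .spoke v ≠ shift x (move l .plus v) := by
  rcases v with v | v <;> simp [move, shift]

theorem powC_eq [Fact p.Prime] (l : (ZMod p)ˣ) : powC l = (1, ofAdd (l : ZMod p)) := by
  refine Prod.ext (powC_fst l) ?_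
  simp [powC, genC, ← ofAdd_nsmul]

theorem adj_iff [Fact p.Prime] (l : (ZMod p)ˣ) (v w : GroupH p ⊕ GroupH p) :
    (NC9 l).Adj v w ↔ ∃ d, w = move (l : ZMod p) d v := by
  have hs : (∃ d, w = move (l : ZMod p) d v) ↔ w = move (l : ZMod p) .spoke v ∨
      w = move (l : ZMod p) .plus v ∨ w = move (l : ZMod p) .minus v := by
    constructor
    · rintro ⟨d, h⟩
      cases d <;> simp [h]
    · rintro (h | h | h) <;> exact ⟨_, h⟩
  rw [hs]
  rcases v with v | v <;> rcases w with w | w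
  · change w * v⁻¹ ∈ setR p ↔ _
    simp only [setR, Set.mem_insert_iff, Set.mem_singleton_iff, mul_inv_eq_iff_eq_mul, move,
      reduceCtorEq, false_or, Sum.inl.injEq]
    simp [Prod.ext_iff, genA, genC]
  · change w * v⁻¹ ∈ ({1} : Set (GroupH p)) ↔ _
    simp [move, mul_inv_eq_one]
  · change v * w⁻¹ ∈ ({1} : Set (GroupH p)) ↔ _
    simp [move, mul_inv_eq_one, eq_comm]
  · change w * v⁻¹ ∈ setL l ↔ _
    simp only [setL, Set.mem_insert_iff, Set.mem_singleton_iff, mul_inv_eq_iff_eq_mul, move,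
      reduceCtorEq, false_or, Sum.inr.injEq]
    simp [Prod.ext_iff, genB, powC_eq]

theorem adj_move [Fact p.Prime] (l : (ZMod p)ˣ) (d : Step) (v : GroupH p ⊕ GroupH p) :
    (NC9 l).Adj v (move (l : ZMod p) d v) := (adj_iff l v _).2 ⟨d, rfl⟩

theorem two_mul_stride_ne_zero [Fact p.Prime] (hp : p ≠ 2) (l : (ZMod p)ˣ)
    (v : GroupH p ⊕ GroupH p) : 2 * stride (l : ZMod p) v ≠ 0 := by
  have h2 : (2 : ZMod p) ≠ 0 := Ring.two_ne_zero (by rwa [ZMod.ringChar_zmod_n])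
  rcases v with v | v <;> simp [stride, h2]

theorem move_plus_ne_minus [Fact p.Prime] (hp : p ≠ 2) (l : (ZMod p)ˣ)
    (v : GroupH p ⊕ GroupH p) : move (l : ZMod p) .plus v ≠ move (l : ZMod p) .minus v := by
  intro h
  rw [move_minus] at h
  have := shift_injective (move (l : ZMod p) .plus v)
    ((shift_zero _).trans h : shift 0 _ = shift _ _)
  exact two_mul_stride_ne_zero hp l v (by simpa using this.symm)

theorem move_injective [Fact p.Prime] (hp : p ≠ 2) (l : (ZMod p)ˣ) (v : GroupH p ⊕ GroupH p) :
    Function.Injective fun d => move (l : ZMod p) d v := by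
  have h1 := move_plus_ne_minus hp l v
  have h2 : move (l : ZMod p) .spoke v ≠ move (l : ZMod p) .plus v := by
    simpa [shift_zero] using move_spoke_ne (l : ZMod p) 0 v
  have h3 : move (l : ZMod p) .spoke v ≠ move (l : ZMod p) .minus v := by
    rw [move_minus]
    exact move_spoke_ne _ _ v
  rintro (_ | _ | _) (_ | _ | _) h <;> first | rfl | exact absurd h ‹_› | exact absurd h.symm ‹_›

/-! ### Valency and connectedness -/

theorem isCubic_NC9 [Fact p.Prime] (hp : p ≠ 2) (l : (ZMod p)ˣ) : IsCubic (NC9 l) := by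
  intro v
  have h : (NC9 l).neighborSet v = {move (l : ZMod p) .spoke v, move (l : ZMod p) .plus v,
      move (l : ZMod p) .minus v} := by
    ext w
    rw [SimpleGraph.mem_neighborSet, adj_iff]
    constructor
    · rintro ⟨d, rfl⟩
      cases d <;> simp
    · rintro (h | h | h) <;> exact ⟨_, h⟩
  have hi := move_injective hp l v
  rw [h, Set.ncard_eq_three]
  exact ⟨_, _, _, hi.ne (by simp), hi.ne (by simp), hi.ne (by simp), rfl⟩

/-- A set of vertices that is closed under shifts, spokes and steps is everything. -/
theorem induction_on_moves (l : ZMod p) {P : GroupH p ⊕ GroupH p → Prop}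
    (hshift : ∀ x v, P v → P (shift x v)) (hspoke : ∀ v, P v → P (move l .spoke v))
    (hplus : ∀ v, P v → P (move l .plus v)) (h1 : P (Sum.inl 1)) (v : GroupH p ⊕ GroupH p) :
    P v := by
  let Q : Perm (Fin 3) → Prop := fun σ => ∀ x, P (Sum.inl (σ, x)) ∧ P (Sum.inr (σ, x))
  have hA : ∀ σ, Q σ → Q (swap 0 1 * σ) := by
    intro σ h x
    have : P (Sum.inl (swap 0 1 * σ, x)) := by
      have h' := hplus _ (h ((ofAdd 1)⁻¹ * x)).1
      rwa [move, mul_inv_cancel_left] at h'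
    exact ⟨this, hspoke _ this⟩
  have hB : ∀ σ, Q σ → Q (swap 1 2 * σ) := by
    intro σ h x
    have : P (Sum.inr (swap 1 2 * σ, x)) := by
      simpa [move] using hplus _ (h (ofAdd (-l) * x)).2
    exact ⟨hspoke _ this, this⟩
  have hQ1 : Q 1 := by
    intro x
    have : P (Sum.inl (1, x)) := by simpa [shift] using hshift x.toAdd _ h1
    exact ⟨this, hspoke _ this⟩
  -- Every element of S₃ as a word in a and b; the trailing factor 1 lets `hA` and `hB` apply
  -- literally, starting from `hQ1`.
  have key : ∀ σ : Perm (Fin 3), σ = 1 ∨ σ = swap 0 1 * 1 ∨ σ = swap 1 2 * 1 ∨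
      σ = swap 0 1 * (swap 1 2 * 1) ∨ σ = swap 1 2 * (swap 0 1 * 1) ∨
      σ = swap 0 1 * (swap 1 2 * (swap 0 1 * 1)) := by decide
  have hQ : ∀ σ, Q σ := by
    intro σ
    rcases key σ with h | h | h | h | h | h <;> rw [h]
    exacts [hQ1, hA _ hQ1, hB _ hQ1, hA _ (hB _ hQ1), hB _ (hA _ hQ1), hA _ (hB _ (hA _ hQ1))]
  rcases v with ⟨σ, x⟩ | ⟨σ, x⟩
  exacts [(hQ σ x).1, (hQ σ x).2]

/-- Every shift is a multiple of the shift by two steps within a copy of `H`. -/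
theorem shift_induction [Fact p.Prime] (hp : p ≠ 2) (l : (ZMod p)ˣ)
    {P : GroupH p ⊕ GroupH p → Prop} {v : GroupH p ⊕ GroupH p} (h0 : P v)
    (hstep : ∀ x, P (shift x v) → P (shift (2 * stride (l : ZMod p) v) (shift x v)))
    (x : ZMod p) : P (shift x v) := by
  have hn : ∀ n : ℕ, P (shift (n * (2 * stride (l : ZMod p) v)) v) := by
    intro n
    induction n with
    | zero => simpa [shift_zero] using h0
    | succ n ih =>
      have := hstep _ ih
      rwa [shift_shift, add_comm, ← add_one_mul, ← Nat.cast_succ] at this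
  -- Twice the stride is invertible modulo p, so this quotient, read as a natural number, is the
  -- number of double steps needed.
  have := hn (x / (2 * stride (l : ZMod p) v)).val
  rwa [ZMod.natCast_zmod_val, div_mul_cancel₀ _ (two_mul_stride_ne_zero hp l v)] at this

theorem connected_NC9 [Fact p.Prime] (hp : p ≠ 2) (l : (ZMod p)ˣ) : (NC9 l).Connected := by
  have hr : ∀ v, (NC9 l).Reachable (Sum.inl 1) v := by
    have hmove : ∀ d v, (NC9 l).Reachable (Sum.inl 1) v →
        (NC9 l).Reachable (Sum.inl 1) (move (l : ZMod p) d v) :=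
      fun d v h => h.trans (adj_move l d v).reachable
    refine induction_on_moves (l : ZMod p) (fun x v h => ?_) (hmove _) (hmove _)
      (SimpleGraph.Reachable.refl _)
    refine shift_induction hp l h (fun y hy => ?_) x
    rw [← stride_shift _ y v, ← move_plus_plus]
    exact hmove _ _ (hmove _ _ hy)
  exact (SimpleGraph.connected_iff_exists_forall_reachable _).2 ⟨_, hr⟩

/-! ### Counting non-backtracking walks -/

section ClosingWalks

variable {V : Type*} [Fintype V]

open Classical in
/-- The number of walks with `n` further steps that continue the arc `(u, v)` without backtracking
and end at `t`. -/
noncomputable def closingWalks (X : SimpleGraph V) (t : V) : ℕ → V → V → ℕ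
  | 0, _, v => if v = t then 1 else 0
  | n + 1, u, v => ∑ w with X.Adj v w ∧ w ≠ u, closingWalks X t n v w

/-- An automorphism maps the continuations of an arc bijectively to those of its image; this makes
the count an invariant of arcs. -/
theorem closingWalks_map (X : SimpleGraph V) (f : X ≃g X) (t : V) (n : ℕ) (u v : V) :
    closingWalks X (f t) n (f u) (f v) = closingWalks X t n u v := by
  classical
  induction n generalizing u v with
  | zero => simp [closingWalks]
  | succ n ih =>
    simp only [closingWalks]
    refine (Finset.sum_bij (fun w _ => f w) ?_ ?_ ?_ ?_).symm
    · intro w hw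
      simpa [f.map_adj_iff] using hw
    · intro w _ w' _ h
      exact f.injective h
    · intro w hw
      refine ⟨f.symm w, ?_, by simp⟩
      rw [Finset.mem_filter] at hw ⊢
      refine ⟨Finset.mem_univ _, ?_, ?_⟩
      · rw [← f.map_adj_iff]
        simpa using hw.2.1
      · rintro h
        exact hw.2.2 (by simp [← h])
    · intro w _
      exact (ih v w).symm

end ClosingWalks

/-! ### The lift to the Gaussian integers and the walk counts -/

section Model

/-- A vertex of the lift of `NC9` to the Gaussian integers: the `q`-th of twelve fibres, and the
exponents of `c` and of `c ^ l`. -/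
abbrev ModelVertex : Type := Fin 12 × ℤ × ℤ

/-- The neighbour of a model vertex in a given direction. -/
def modelMove : Step → ModelVertex → ModelVertex
  | .spoke, s => (if s.1.val % 2 = 0 then s.1 - 1 else s.1 + 1, s.2)
  | .plus, s => (if s.1.val % 2 = 0 then s.1 + 1 else s.1 - 1,
      if s.1.val % 4 < 2 then (s.2.1 + 1, s.2.2) else (s.2.1, s.2.2 + 1))
  | .minus, s => (if s.1.val % 2 = 0 then s.1 + 1 else s.1 - 1,
      if s.1.val % 4 < 2 then (s.2.1 - 1, s.2.2) else (s.2.1, s.2.2 - 1))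

/-- The exponents at those ends of the non-backtracking walks with `n` steps that lie in the first
fibre. The walks start at `s`, which has been reached by a step in the direction `d`. -/
def modelEnds : ℕ → Step → ModelVertex → List (ℤ × ℤ)
  | 0, _, s => if s.1 = 0 then [s.2] else []
  | n + 1, .spoke, s => modelEnds n .plus (modelMove .plus s) ++
      modelEnds n .minus (modelMove .minus s)
  | n + 1, .plus, s => modelEnds n .spoke (modelMove .spoke s) ++
      modelEnds n .plus (modelMove .plus s)
  | n + 1, .minus, s => modelEnds n .spoke (modelMove .spoke s) ++
      modelEnds n .minus (modelMove .minus s)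

/-- The component in `S₃` of the vertices of a fibre. -/
def fibrePerm : Fin 12 → Perm (Fin 3) :=
  ![1, swap 0 1, swap 0 1, swap 1 2 * swap 0 1, swap 1 2 * swap 0 1,
    swap 0 1 * (swap 1 2 * swap 0 1), swap 0 1 * (swap 1 2 * swap 0 1), swap 0 1 * swap 1 2,
    swap 0 1 * swap 1 2, swap 1 2, swap 1 2, 1]

/-- The vertex of `NC9` below a model vertex. -/
def ofModel (l : ZMod p) (s : ModelVertex) : GroupH p ⊕ GroupH p :=
  if s.1.val % 4 < 2 then Sum.inl (fibrePerm s.1, ofAdd (s.2.1 + s.2.2 * l))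
  else Sum.inr (fibrePerm s.1, ofAdd (s.2.1 + s.2.2 * l))

/-- Modulo c the graph is a 12-cycle in which spokes alternate with double edges. The fibres are
numbered along it, cyclically in `Fin 12`; residues 0 and 1 modulo 4 belong to the first copy of
`H`. -/
theorem fibrePerm_spoke (q : Fin 12) :
    fibrePerm (if q.val % 2 = 0 then q - 1 else q + 1) = fibrePerm q := by
  revert q
  decide

theorem fibrePerm_step (q : Fin 12) :
    fibrePerm (if q.val % 2 = 0 then q + 1 else q - 1) =
      (if q.val % 4 < 2 then swap 0 1 else swap 1 2) * fibrePerm q := by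
  revert q
  decide

/-- Substituting λ for i is compatible with the moves, so walks in the graph can be computed in the
model. -/
theorem ofModel_modelMove (l : ZMod p) (d : Step) (s : ModelVertex) :
    ofModel l (modelMove d s) = move l d (ofModel l s) := by
  obtain ⟨q, a, b⟩ := s
  have h1 := fibrePerm_spoke q
  have h2 := fibrePerm_step q
  have h3 : (if q.val % 2 = 0 then q - 1 else q + 1).val % 4 < 2 ↔ ¬ q.val % 4 < 2 := by
    revert q; decide
  have h4 : (if q.val % 2 = 0 then q + 1 else q - 1).val % 4 < 2 ↔ q.val % 4 < 2 := by
    revert q; decide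
  cases d <;> by_cases h : q.val % 4 < 2 <;>
    simp only [ofModel, modelMove, h1, h2, h3, h4, h, move, if_true, if_false, not_true_eq_false,
      not_false_eq_true, ← ofAdd_add] <;>
    congr 3 <;> push_cast <;> ring

/-- Fibres 0 and 11 both have trivial permutation, but only fibre 0 lies in the first copy. -/
theorem ofModel_eq_iff (l : ZMod p) (s : ModelVertex) :
    ofModel l s = Sum.inl 1 ↔ s.1 = 0 ∧ (s.2.1 + s.2.2 * l : ZMod p) = 0 := by
  obtain ⟨q, a, b⟩ := s
  have hq : q.val % 4 < 2 → (fibrePerm q = 1 ↔ q = 0) := by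
    revert q; decide
  have hq' : ¬ q.val % 4 < 2 → q ≠ 0 := by
    revert q; decide
  by_cases h : q.val % 4 < 2
  · simp [ofModel, h, hq h, Prod.ext_iff, -ofAdd_add, ofAdd_eq_one]
  · simp [ofModel, h, hq' h]

theorem filter_adj_ne [Fact p.Prime] (hp : p ≠ 2) (l : (ZMod p)ˣ) (v : GroupH p ⊕ GroupH p)
    (d e e' : Step) (h : ({d, e, e'} : Set Step) = Set.univ) (he : e ≠ d) (he' : e' ≠ d)
    (w : GroupH p ⊕ GroupH p) :
    ((NC9 l).Adj v w ∧ w ≠ move (l : ZMod p) d v) ↔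
      w = move (l : ZMod p) e v ∨ w = move (l : ZMod p) e' v := by
  have hi := move_injective hp l v
  rw [adj_iff]
  constructor
  · rintro ⟨⟨f, rfl⟩, hf⟩
    have : f ∈ ({d, e, e'} : Set Step) := h ▸ Set.mem_univ f
    rcases this with rfl | rfl | rfl
    · exact absurd rfl hf
    · exact Or.inl rfl
    · exact Or.inr rfl
  · rintro (rfl | rfl)
    exacts [⟨⟨_, rfl⟩, hi.ne he⟩, ⟨⟨_, rfl⟩, hi.ne he'⟩]

/-- Naming the previous vertex by the opposite direction turns the ban on backtracking into a ban on
one direction; the other two lead to distinct vertices because p is odd. -/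
theorem closingWalks_succ [Fact p.Prime] (hp : p ≠ 2) (l : (ZMod p)ˣ)
    (t v : GroupH p ⊕ GroupH p) (n : ℕ) (d e e' : Step)
    (h : ({d.op, e, e'} : Set Step) = Set.univ) (he : e ≠ d.op) (he' : e' ≠ d.op) (hee : e ≠ e') :
    closingWalks (NC9 l) t (n + 1) (move (l : ZMod p) d.op v) v =
      closingWalks (NC9 l) t n (move (l : ZMod p) e.op (move (l : ZMod p) e v))
        (move (l : ZMod p) e v) +
      closingWalks (NC9 l) t n (move (l : ZMod p) e'.op (move (l : ZMod p) e' v))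
        (move (l : ZMod p) e' v) := by
  classical
  have hf : (Finset.univ.filter fun w => (NC9 l).Adj v w ∧ w ≠ move (l : ZMod p) d.op v) =
      {move (l : ZMod p) e v, move (l : ZMod p) e' v} := by
    ext w
    simp [filter_adj_ne hp l v d.op e e' h he he']
  rw [move_op_move, move_op_move, closingWalks]
  convert Finset.sum_pair ((move_injective hp l v).ne hee) using 2
  convert hf

theorem closingWalks_eq_countP [Fact p.Prime] (hp : p ≠ 2) (l : (ZMod p)ˣ) (n : ℕ) (d : Step)
    (s : ModelVertex) :
    closingWalks (NC9 l) (Sum.inl 1) n (move (l : ZMod p) d.op (ofModel (l : ZMod p) s))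
      (ofModel (l : ZMod p) s) =
    (modelEnds n d s).countP fun e => (e.1 + e.2 * l : ZMod p) = 0 := by
  have hu : ∀ a b c : Step, (∀ f, f = a ∨ f = b ∨ f = c) → ({a, b, c} : Set Step) = Set.univ :=
    fun a b c h => Set.eq_univ_of_forall h
  induction n generalizing d s with
  | zero =>
    by_cases h0 : s.1 = 0 <;> simp [closingWalks, modelEnds, ofModel_eq_iff, h0, List.countP_cons]
  | succ n ih =>
    have ih' : ∀ e : Step, closingWalks (NC9 l) (Sum.inl 1) n
        (move (l : ZMod p) e.op (move (l : ZMod p) e (ofModel (l : ZMod p) s)))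
        (move (l : ZMod p) e (ofModel (l : ZMod p) s)) =
        (modelEnds n e (modelMove e s)).countP fun e => (e.1 + e.2 * l : ZMod p) = 0 := by
      intro e
      rw [← ofModel_modelMove, ih]
    have hs := fun e e' => closingWalks_succ hp l (Sum.inl 1) (ofModel (l : ZMod p) s) n d e e'
    cases d
    · rw [hs .plus .minus (hu _ _ _ (by rintro (_ | _ | _) <;> simp [Step.op])) (by simp [Step.op])
        (by simp [Step.op]) (by simp), ih', ih', modelEnds, List.countP_append]
    · rw [hs .spoke .plus (hu _ _ _ (by rintro (_ | _ | _) <;> simp [Step.op])) (by simp [Step.op])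
        (by simp [Step.op]) (by simp), ih', ih', modelEnds, List.countP_append]
    · rw [hs .spoke .minus (hu _ _ _ (by rintro (_ | _ | _) <;> simp [Step.op])) (by simp [Step.op])
        (by simp [Step.op]) (by simp), ih', ih', modelEnds, List.countP_append]

/-- The ends of the walks with ten steps which leave the base vertex in the direction `d`. -/
def loopEnds (d : Step) : List (ℤ × ℤ) := modelEnds 9 d (modelMove d (0, 0, 0))

/-- Apart from zero, the Gaussian integers that occur as ends of the walks have norms with prime
divisors `2`, `3` and `5` only. -/
theorem norm_of_mem_loopEnds (d : Step) :
    ∀ e ∈ loopEnds d, e = 0 ∨ e.1 * e.1 + e.2 * e.2 ∣ 2 ^ 6 * 3 ^ 2 * 5 ^ 2 := by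
  cases d <;> decide +kernel

theorem countP_loopEnds_zero :
    (loopEnds .spoke).countP (fun e => e = 0) = 8 ∧
    (loopEnds .plus).countP (fun e => e = 0) = 6 ∧
    (loopEnds .minus).countP (fun e => e = 0) = 6 := by
  decide +kernel

/-- Since 5 is among the primes allowed in the norms, the ends vanishing modulo 5 are counted
directly, for both square roots of -1. -/
theorem countP_loopEnds_five (l : ZMod 5) (hl : l * l = -1) :
    (loopEnds .spoke).countP (fun e => (e.1 + e.2 * l : ZMod 5) = 0) = 24 ∧
    (loopEnds .plus).countP (fun e => (e.1 + e.2 * l : ZMod 5) = 0) = 22 ∧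
    (loopEnds .minus).countP (fun e => (e.1 + e.2 * l : ZMod 5) = 0) = 22 := by
  revert l
  decide +kernel

theorem closingWalks_base [Fact p.Prime] (hp : p ≠ 2) (l : (ZMod p)ˣ) (d : Step) :
    closingWalks (NC9 l) (Sum.inl 1) 9 (Sum.inl 1) (move (l : ZMod p) d (Sum.inl 1)) =
      (loopEnds d).countP fun e => (e.1 + e.2 * l : ZMod p) = 0 := by
  have h0 : ofModel (l : ZMod p) (0, 0, 0) = Sum.inl 1 := by simp [ofModel_eq_iff]
  rw [loopEnds, ← closingWalks_eq_countP hp, ofModel_modelMove, move_op_move, h0]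

/-- As λ² = -1, a² + b² = (a + bλ)(a - bλ) modulo p. A nonzero end that vanishes modulo p would thus
have norm divisible by p, which the bound on the norms forbids. -/
theorem countP_loopEnds [Fact p.Prime] (hp : p ≠ 2) (hp3 : p ≠ 3) (hp5 : p ≠ 5) (l : ZMod p)
    (hl : l * l = -1) (d : Step) :
    ((loopEnds d).countP fun e => (e.1 + e.2 * l : ZMod p) = 0) =
      (loopEnds d).countP fun e => e = 0 := by
  refine List.countP_congr fun e he => ?_
  simp only [decide_eq_true_eq]
  constructor
  · intro h
    refine (norm_of_mem_loopEnds d e he).resolve_right fun hd => ?_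
    have hn : ((e.1 * e.1 + e.2 * e.2 : ℤ) : ZMod p) = 0 := by
      push_cast
      linear_combination (e.1 - e.2 * l : ZMod p) * h + (e.2 * e.2 : ZMod p) * hl
    have hd' : (p : ℤ) ∣ ((2 ^ 6 * 3 ^ 2 * 5 ^ 2 : ℕ) : ℤ) := by
      push_cast
      exact ((ZMod.intCast_zmod_eq_zero_iff_dvd _ _).1 hn).trans hd
    have hpp : p.Prime := Fact.out
    rcases (hpp.dvd_mul.1 (Int.natCast_dvd_natCast.1 hd')) with h' | h'
    · rcases hpp.dvd_mul.1 h' with h' | h'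
      · exact hp ((Nat.prime_dvd_prime_iff_eq hpp Nat.prime_two).1 (hpp.dvd_of_dvd_pow h'))
      · exact hp3 ((Nat.prime_dvd_prime_iff_eq hpp Nat.prime_three).1 (hpp.dvd_of_dvd_pow h'))
    · exact hp5 ((Nat.prime_dvd_prime_iff_eq hpp Nat.prime_five).1 (hpp.dvd_of_dvd_pow h'))
  · rintro rfl
    simp

/-- Spokes lie on a different number of closed walks of length ten than the other edges. -/
theorem closingWalks_spoke_ne [Fact p.Prime] (hp : p ≠ 2) (hp3 : p ≠ 3) (l : (ZMod p)ˣ)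
    (hl : (l * l : ZMod p) = -1) (d : Step)
    (h : closingWalks (NC9 l) (Sum.inl 1) 9 (Sum.inl 1) (move (l : ZMod p) d (Sum.inl 1)) =
      closingWalks (NC9 l) (Sum.inl 1) 9 (Sum.inl 1) (move (l : ZMod p) .spoke (Sum.inl 1))) :
    d = .spoke := by
  rw [closingWalks_base hp, closingWalks_base hp] at h
  by_cases hp5 : p = 5
  · subst hp5
    obtain ⟨h1, h2, h3⟩ := countP_loopEnds_five _ hl
    cases d
    · rfl
    · rw [h1, h2] at h
      omega
    · rw [h1, h3] at h
      omega
  · rw [countP_loopEnds hp hp3 hp5 _ hl, countP_loopEnds hp hp3 hp5 _ hl] at h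
    obtain ⟨h1, h2, h3⟩ := countP_loopEnds_zero
    cases d
    · rfl
    · rw [h1, h2] at h
      omega
    · rw [h1, h3] at h
      omega

end Model

/-! ### The known automorphisms -/

/-- Right multiplication by elements of `H` on both copies of `H`. -/
def rightMul (l : (ZMod p)ˣ) : GroupH p →* (NC9 l ≃g NC9 l) where
  toFun g :=
    -- The inverse makes right multiplication a left action, hence a homomorphism; adjacency depends
    -- only on y x⁻¹, which does not change.
    { toEquiv := Equiv.sumCongr (Equiv.mulRight g⁻¹) (Equiv.mulRight g⁻¹)
      map_rel_iff' := by
        have h : ∀ x y : GroupH p, y * g⁻¹ * (x * g⁻¹)⁻¹ = y * x⁻¹ := fun x y => by group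
        rintro (x | x) (y | y)
        · exact iff_of_eq (congrArg (· ∈ setR p) (h x y))
        · exact iff_of_eq (congrArg (· ∈ ({1} : Set (GroupH p))) (h x y))
        · exact iff_of_eq (congrArg (· ∈ ({1} : Set (GroupH p))) (h y x))
        · exact iff_of_eq (congrArg (· ∈ setL l) (h x y)) }
  map_one' := by
    ext (x | x) : 1
    · exact congrArg Sum.inl (by simp)
    · exact congrArg Sum.inr (by simp)
  map_mul' g g' := by
    ext (x | x) : 1
    · exact congrArg Sum.inl (by simp [mul_assoc])
    · exact congrArg Sum.inr (by simp [mul_assoc])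

theorem rightMul_inl (l : (ZMod p)ˣ) (g h : GroupH p) :
    rightMul l g (Sum.inl h) = Sum.inl (h * g⁻¹) := rfl

theorem rightMul_inr (l : (ZMod p)ˣ) (g h : GroupH p) :
    rightMul l g (Sum.inr h) = Sum.inr (h * g⁻¹) := rfl

/-- The automorphism of `H` with `a ↦ b`, `b ↦ a`, `c ↦ c ^ l`. -/
def twistAut (l : (ZMod p)ˣ) : MulAut (GroupH p) :=
  -- Conjugation by (0 2) exchanges the transpositions (0 1) and (1 2).
  MulEquiv.prodCongr (MulAut.conj (swap 0 2))
    (AddEquiv.toMultiplicative (DistribMulAction.toAddEquiv (ZMod p) l))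

theorem twistAut_apply (l : (ZMod p)ˣ) (σ : Perm (Fin 3)) (x : ZMod p) :
    twistAut l (σ, ofAdd x) = (swap 0 2 * σ * swap 0 2, ofAdd (l * x)) := rfl

theorem twistAut_genA (l : (ZMod p)ˣ) : twistAut l (genA p) = genB p := by
  refine Prod.ext ?_ ?_
  · change swap (0 : Fin 3) 2 * swap 0 1 * swap 0 2 = swap 1 2
    decide
  · exact congrArg ofAdd (mul_zero (l : ZMod p))

theorem twistAut_genB (l : (ZMod p)ˣ) : twistAut l (genB p) = genA p := by
  refine Prod.ext ?_ ?_
  · change swap (0 : Fin 3) 2 * swap 1 2 * swap 0 2 = swap 0 1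
    decide
  · exact congrArg ofAdd (mul_zero (l : ZMod p))

theorem twistAut_genC [Fact p.Prime] (l : (ZMod p)ˣ) : twistAut l (genC p) = powC l := by
  rw [genC, powC_eq, twistAut_apply]
  simp

theorem twistAut_twistAut {l : (ZMod p)ˣ} (hl : (l * l : ZMod p) = -1) (h : GroupH p) :
    twistAut l (twistAut l h) = (h.1, h.2⁻¹) := by
  obtain ⟨σ, x⟩ := h
  have hx := twistAut_apply l σ x.toAdd
  rw [ofAdd_toAdd] at hx
  rw [hx, twistAut_apply]
  refine Prod.ext (by simp [mul_assoc]) ?_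
  change ofAdd (l * (l * x.toAdd) : ZMod p) = x⁻¹
  rw [← mul_assoc, hl, neg_one_mul, ofAdd_neg, ofAdd_toAdd]

theorem twistAut_powC [Fact p.Prime] {l : (ZMod p)ˣ} (hl : (l * l : ZMod p) = -1) :
    twistAut l (powC l) = (genC p)⁻¹ := by
  rw [← twistAut_genC, twistAut_twistAut hl]
  simp [genC]

theorem twistAut_pow_four {l : (ZMod p)ˣ} (hl : (l * l : ZMod p) = -1) : twistAut l ^ 4 = 1 := by
  refine MulEquiv.ext fun h => ?_
  change twistAut l (twistAut l (twistAut l (twistAut l h))) = h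
  simp [twistAut_twistAut hl]

theorem twistAut_mem_setL [Fact p.Prime] (l : (ZMod p)ˣ) (h : GroupH p) :
    twistAut l h ∈ setL l ↔ h ∈ setR p := by
  simp only [setL, setR, Set.mem_insert_iff, Set.mem_singleton_iff, ← twistAut_genC l,
    ← twistAut_genA l, ← map_inv, ← map_mul, (twistAut l).injective.eq_iff]

/-- Here λ² = -1 is essential: c^λ goes to c⁻¹, so L returns to R with its two elements in the
opposite order. -/
theorem twistAut_mem_setR [Fact p.Prime] {l : (ZMod p)ˣ} (hl : (l * l : ZMod p) = -1)
    (h : GroupH p) : twistAut l h ∈ setR p ↔ h ∈ setL l := by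
  have hc : genC p = twistAut l (powC l)⁻¹ := by rw [map_inv, twistAut_powC hl, inv_inv]
  simp only [setL, setR, Set.mem_insert_iff, Set.mem_singleton_iff]
  rw [hc, ← twistAut_genB l]
  simp only [← map_inv, ← map_mul, (twistAut l).injective.eq_iff, inv_inv]
  exact or_comm

/-- The automorphism of `NC9` that applies `twistAut` and exchanges the two copies of `H`. -/
def twist [Fact p.Prime] {l : (ZMod p)ˣ} (hl : (l * l : ZMod p) = -1) : NC9 l ≃g NC9 l where
  toEquiv := (Equiv.sumCongr (twistAut l).toEquiv (twistAut l).toEquiv).trans (Equiv.sumComm _ _)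
  map_rel_iff' := by
    have h : ∀ x y : GroupH p, twistAut l y * (twistAut l x)⁻¹ = twistAut l (y * x⁻¹) := by
      simp
    have h1 : ∀ x y : GroupH p, twistAut l y * (twistAut l x)⁻¹ ∈ ({1} : Set (GroupH p)) ↔
        y * x⁻¹ ∈ ({1} : Set (GroupH p)) := by
      simp [mul_inv_eq_one]
    rintro (x | x) (y | y)
    · change twistAut l y * (twistAut l x)⁻¹ ∈ setL l ↔ y * x⁻¹ ∈ setR p
      rw [h, twistAut_mem_setL]
    · change twistAut l x * (twistAut l y)⁻¹ ∈ ({1} : Set (GroupH p)) ↔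
        y * x⁻¹ ∈ ({1} : Set (GroupH p))
      rw [h1, Set.mem_singleton_iff, Set.mem_singleton_iff, mul_inv_eq_one, mul_inv_eq_one,
        eq_comm]
    · change twistAut l y * (twistAut l x)⁻¹ ∈ ({1} : Set (GroupH p)) ↔
        x * y⁻¹ ∈ ({1} : Set (GroupH p))
      rw [h1, Set.mem_singleton_iff, Set.mem_singleton_iff, mul_inv_eq_one, mul_inv_eq_one,
        eq_comm]
    · change twistAut l y * (twistAut l x)⁻¹ ∈ setR p ↔ y * x⁻¹ ∈ setL l
      rw [h, twistAut_mem_setR hl]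

section Twist

variable [Fact p.Prime] {l : (ZMod p)ˣ} (hl : (l * l : ZMod p) = -1)

theorem twist_inl (h : GroupH p) : twist hl (Sum.inl h) = Sum.inr (twistAut l h) := rfl

theorem twist_inr (h : GroupH p) : twist hl (Sum.inr h) = Sum.inl (twistAut l h) := rfl

theorem twist_twist_inl (h : GroupH p) :
    twist hl (twist hl (Sum.inl h)) = Sum.inl (h.1, h.2⁻¹) := by
  rw [twist_inl, twist_inr, twistAut_twistAut hl]

theorem twist_twist_inr (h : GroupH p) :
    twist hl (twist hl (Sum.inr h)) = Sum.inr (h.1, h.2⁻¹) := by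
  rw [twist_inr, twist_inl, twistAut_twistAut hl]

theorem twist_pow_four : twist hl ^ 4 = 1 := by
  refine RelIso.ext fun v => ?_
  change twist hl (twist hl (twist hl (twist hl v))) = v
  rcases v with v | v
  · simp [twist_twist_inl]
  · simp [twist_twist_inr]

theorem twist_mul_rightMul (g : GroupH p) :
    twist hl * rightMul l g = rightMul l (twistAut l g) * twist hl := by
  refine RelIso.ext fun v => ?_
  rcases v with v | v <;>
    simp [RelIso.mul_apply, rightMul_inl, rightMul_inr, twist_inl, twist_inr]

theorem twist_pow_mul_rightMul (n : ℕ) (g : GroupH p) :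
    twist hl ^ n * rightMul l g = rightMul l ((twistAut l ^ n) g) * twist hl ^ n := by
  induction n with
  | zero => simp
  | succ n ih =>
    rw [pow_succ', mul_assoc, ih, ← mul_assoc, twist_mul_rightMul, mul_assoc, pow_succ',
      MulAut.mul_apply]

theorem rightMul_move_spoke (g : GroupH p) (v : GroupH p ⊕ GroupH p) :
    rightMul l g (move (l : ZMod p) .spoke v) = move (l : ZMod p) .spoke (rightMul l g v) := by
  rcases v with v | v <;> rfl

theorem twist_move_spoke (v : GroupH p ⊕ GroupH p) :
    twist hl (move (l : ZMod p) .spoke v) = move (l : ZMod p) .spoke (twist hl v) := by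
  rcases v with v | v <;> rfl

/-- Every vertex is the image of the base vertex under an automorphism that preserves spokes. -/
theorem exists_map_base_eq (v : GroupH p ⊕ GroupH p) :
    ∃ (g : GroupH p) (n : ℕ), (rightMul l g * twist hl ^ n) (Sum.inl 1) = v ∧
      ∀ w, (rightMul l g * twist hl ^ n) (move (l : ZMod p) .spoke w) =
        move (l : ZMod p) .spoke ((rightMul l g * twist hl ^ n) w) := by
  rcases v with v | v
  · refine ⟨v⁻¹, 0, ?_, fun w => ?_⟩
    · rw [pow_zero, mul_one, rightMul_inl, one_mul, inv_inv]
    · rw [pow_zero, mul_one, rightMul_move_spoke]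
  · refine ⟨v⁻¹, 1, ?_, fun w => ?_⟩
    · rw [pow_one, RelIso.mul_apply, twist_inl, map_one, rightMul_inr, one_mul, inv_inv]
    · rw [pow_one, RelIso.mul_apply, twist_move_spoke, rightMul_move_spoke, RelIso.mul_apply]

theorem isVertexTransitive_NC9 (hl : (l * l : ZMod p) = -1) : IsVertexTransitive (NC9 l) := by
  intro u v
  obtain ⟨g, n, hg, -⟩ := exists_map_base_eq hl u
  obtain ⟨g', n', hg', -⟩ := exists_map_base_eq hl v
  refine ⟨(rightMul l g' * twist hl ^ n') * (rightMul l g * twist hl ^ n)⁻¹, ?_⟩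
  rw [RelIso.mul_apply, ← hg, RelIso.inv_apply_self, hg']

/-! ### Rigidity: spokes and the vertex stabilizer -/

/-- Every automorphism of `NC9` preserves the spokes. -/
theorem map_move_spoke (hl : (l * l : ZMod p) = -1) (hp : p ≠ 2) (hp3 : p ≠ 3)
    (f : NC9 l ≃g NC9 l) (v : GroupH p ⊕ GroupH p) :
    f (move (l : ZMod p) .spoke v) = move (l : ZMod p) .spoke (f v) := by
  obtain ⟨g, n, hg, hs⟩ := exists_map_base_eq hl v
  obtain ⟨g', n', hg', hs'⟩ := exists_map_base_eq hl (f v)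
  -- Only two properties of these automorphisms matter: they move the base vertex to v and to f v,
  -- and they preserve spokes. Conjugating by them reduces to an automorphism fixing the base
  -- vertex, where the walk counts apply.
  generalize rightMul l g * twist hl ^ n = m at hg hs
  generalize rightMul l g' * twist hl ^ n' = m' at hg' hs'
  have hF : (m'⁻¹ * f * m) (Sum.inl 1) = Sum.inl 1 := by
    rw [RelIso.mul_apply, RelIso.mul_apply, hg, ← hg', RelIso.inv_apply_self]
  have hadj := (m'⁻¹ * f * m).map_adj_iff.2 (adj_move l .spoke (Sum.inl 1))
  rw [hF, adj_iff] at hadj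
  obtain ⟨d, hd⟩ := hadj
  have hc := closingWalks_map (NC9 l) (m'⁻¹ * f * m) (Sum.inl 1) 9 (Sum.inl 1)
    (move (l : ZMod p) .spoke (Sum.inl 1))
  rw [hF, hd] at hc
  rw [closingWalks_spoke_ne hp hp3 l hl d hc] at hd
  rw [RelIso.mul_apply, RelIso.mul_apply, hs, hg] at hd
  rw [← hg', ← hs', ← hd, RelIso.apply_inv_self]

/-- An automorphism that fixes a vertex and its neighbour in direction `plus` is trivial. -/
theorem eq_one_of_map_eq (hl : (l * l : ZMod p) = -1) (hp : p ≠ 2) (hp3 : p ≠ 3)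
    (f : NC9 l ≃g NC9 l) (h1 : f (Sum.inl 1) = Sum.inl 1)
    (h2 : f (move (l : ZMod p) .plus (Sum.inl 1)) = move (l : ZMod p) .plus (Sum.inl 1)) :
    f = 1 := by
  have hsp := map_move_spoke hl hp hp3 f
  have hnb : ∀ d v, f v = v → ∃ e, f (move (l : ZMod p) d v) = move (l : ZMod p) e v := by
    intro d v hv
    have := f.map_adj_iff.2 (adj_move l d v)
    rwa [hv, adj_iff] at this
  have hpm : ∀ v, f v = v → f (move (l : ZMod p) .plus v) = move (l : ZMod p) .plus v ∨
      f (move (l : ZMod p) .plus v) = move (l : ZMod p) .minus v := by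
    intro v hv
    obtain ⟨e, he⟩ := hnb .plus v hv
    cases e
    · have := f.injective (he.trans ((hsp v).trans (by rw [hv])).symm)
      exact absurd (move_injective hp l v this) (by simp)
    · exact Or.inl he
    · exact Or.inr he
  have hback : ∀ v, f v = v → f (move (l : ZMod p) .minus v) = move (l : ZMod p) .minus v →
      f (move (l : ZMod p) .plus v) = move (l : ZMod p) .plus v := by
    intro v hv hm
    refine (hpm v hv).resolve_right fun h => ?_
    exact absurd (move_injective hp l v (f.injective (h.trans hm.symm))) (by simp)
  have hnext : ∀ v, f v = v → f (move (l : ZMod p) .plus v) = move (l : ZMod p) .plus v →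
      f (shift (2 * stride (l : ZMod p) v) v) = shift (2 * stride (l : ZMod p) v) v := by
    intro v hv hv'
    rw [← move_plus_plus]
    refine hback _ hv' ?_
    rwa [show move (l : ZMod p) .minus (move (l : ZMod p) .plus v) = v from
      move_op_move (l : ZMod p) .plus v]
  -- Repeated `plus` moves run round a 2p-cycle; once two consecutive vertices are fixed, each next
  -- one is forced.
  have hcycle : ∀ v, f v = v → f (move (l : ZMod p) .plus v) = move (l : ZMod p) .plus v →
      ∀ x, f (shift x v) = shift x v ∧
        f (move (l : ZMod p) .plus (shift x v)) = move (l : ZMod p) .plus (shift x v) := by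
    intro v hv hv'
    refine shift_induction hp l (P := fun w => f w = w ∧
      f (move (l : ZMod p) .plus w) = move (l : ZMod p) .plus w) ⟨hv, hv'⟩ fun x hx => ?_
    have h := hnext _ hx.1 hx.2
    rw [stride_shift] at h
    refine ⟨h, ?_⟩
    refine hback _ h ?_
    rw [← stride_shift (l : ZMod p) x v, ← move_plus_plus]
    rw [show move (l : ZMod p) .minus (move (l : ZMod p) .plus
      (move (l : ZMod p) .plus (shift x v))) = _ from move_op_move (l : ZMod p) .plus _]
    exact hx.2
  -- The vertex in direction `plus` is adjacent both to v and to its shift by twice the stride. The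
  -- one in direction `minus` is not adjacent to that shift, since four times the stride is nonzero,
  -- so the two cannot be exchanged.
  have hfibre : ∀ v, (∀ x, f (shift x v) = shift x v) →
      f (move (l : ZMod p) .plus v) = move (l : ZMod p) .plus v := by
    intro v hv
    have hv0 : f v = v := by simpa [shift_zero] using hv 0
    refine (hpm v hv0).resolve_right fun h => ?_
    have hadj := f.map_adj_iff.2 (adj_move l .plus (move (l : ZMod p) .plus v))
    rw [move_plus_plus, hv, h, adj_iff] at hadj
    obtain ⟨d, hd⟩ := hadj
    have h2 := two_mul_stride_ne_zero hp l v
    have hmm : move (l : ZMod p) .plus (move (l : ZMod p) .minus v) = v :=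
      move_op_move (l : ZMod p) .minus v
    cases d
    · have hne := move_spoke_ne (l : ZMod p) (2 * stride (l : ZMod p) v)
        (move (l : ZMod p) .minus v)
      rw [hmm] at hne
      exact hne hd.symm
    · rw [hmm] at hd
      exact h2 (shift_injective v (hd.trans (shift_zero v).symm))
    · have hs : stride (l : ZMod p) (move (l : ZMod p) .minus v) = stride (l : ZMod p) v := by
        rcases v with v | v <;> rfl
      rw [move_minus, hmm, hs] at hd
      have h4 : 2 * stride (l : ZMod p) v = -(2 * stride (l : ZMod p) v) := shift_injective v hd
      have h22 : (2 : ZMod p) ≠ 0 := left_ne_zero_of_mul h2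
      have h40 : 2 * (2 * stride (l : ZMod p) v) = 0 := by linear_combination h4
      exact (mul_ne_zero h22 h2) h40
  -- The property propagated is that the whole orbit under powers of c is fixed: along spokes
  -- because they are preserved, along `plus` moves by `hfibre`.
  have hall : ∀ v, ∀ x, f (shift x v) = shift x v := by
    refine induction_on_moves (l : ZMod p) ?_ ?_ ?_ ?_
    · intro x v hv y
      rw [shift_shift, hv]
    · intro v hv x
      rw [← move_shift, hsp, hv]
    · intro v hv x
      rw [← move_shift]
      refine hfibre _ fun y => ?_
      rw [shift_shift, hv]
    · exact fun x => (hcycle _ h1 h2 x).1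
  refine RelIso.ext fun v => ?_
  simpa [shift_zero] using hall v 0

theorem twist_sq_base : (twist hl ^ 2) (Sum.inl 1) = Sum.inl 1 := by
  rw [pow_two, RelIso.mul_apply, twist_twist_inl]
  simp

theorem twist_sq_ne_one (hp : p ≠ 2) : twist hl ^ 2 ≠ 1 := by
  intro h
  have h' := DFunLike.congr_fun h (Sum.inl (genC p))
  rw [pow_two, RelIso.mul_apply, twist_twist_inl, RelIso.one_apply] at h'
  have h1 : (-1 : ZMod p) = 1 :=
    Multiplicative.ofAdd.injective (congrArg Prod.snd (Sum.inl_injective h'))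
  have h2 : (2 : ZMod p) ≠ 0 := Ring.two_ne_zero (by rwa [ZMod.ringChar_zmod_n])
  exact h2 (by linear_combination -h1)

/-- The stabilizer of the base vertex has order two. -/
theorem eq_one_or_eq_twist_sq (hp : p ≠ 2) (hp3 : p ≠ 3)
    (f : NC9 l ≃g NC9 l) (h1 : f (Sum.inl 1) = Sum.inl 1) : f = 1 ∨ f = twist hl ^ 2 := by
  have hadj := f.map_adj_iff.2 (adj_move l .plus (Sum.inl 1))
  rw [h1, adj_iff] at hadj
  obtain ⟨d, hd⟩ := hadj
  cases d
  · have hs := map_move_spoke hl hp hp3 f (Sum.inl 1)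
    rw [h1] at hs
    exact absurd (move_injective hp l _ (f.injective (hd.trans hs.symm))) (by simp)
  · exact Or.inl (eq_one_of_map_eq hl hp hp3 f h1 hd)
  · right
    -- The square of `twist` inverts c, so it undoes the exchange of the two neighbours in the same
    -- copy.
    have ht : (twist hl ^ 2) (move (l : ZMod p) .minus (Sum.inl 1)) =
        move (l : ZMod p) .plus (Sum.inl 1) := by
      rw [pow_two, RelIso.mul_apply]
      simp only [move]
      rw [twist_twist_inl]
      simp
    have h := eq_one_of_map_eq hl hp hp3 (twist hl ^ 2 * f)
      (by rw [RelIso.mul_apply, h1, twist_sq_base]) (by rw [RelIso.mul_apply, hd, ht])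
    have h4 : twist hl ^ 2 * twist hl ^ 2 = 1 := by rw [← pow_add, twist_pow_four]
    exact mul_left_cancel (h.trans h4.symm)

/-! ### Failure of arc-transitivity and of the Cayley property -/

theorem not_isArcTransitive_NC9 (hl : (l * l : ZMod p) = -1) (hp : p ≠ 2) (hp3 : p ≠ 3) :
    ¬ IsArcTransitive (NC9 l) := by
  intro h
  obtain ⟨f, h1, h2⟩ := h _ _ _ _ (adj_move l .spoke (Sum.inl 1)) (adj_move l .plus (Sum.inl 1))
  rw [map_move_spoke hl hp hp3, h1] at h2
  exact absurd (move_injective hp l _ h2) (by simp)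

/-- A regular subgroup would contain `twist`, hence also its square, which has fixed points. -/
theorem not_isCayley_NC9 (hl : (l * l : ZMod p) = -1) (hp : p ≠ 2) (hp3 : p ≠ 3) :
    ¬ IsCayley (NC9 l) := by
  rintro ⟨G, _, S, -, -, ⟨e⟩⟩
  let L : G → (SimpleGraph.mulCayley S ≃g SimpleGraph.mulCayley S) := fun g =>
    { toEquiv := Equiv.mulLeft g
      map_rel_iff' := by
        intro x y
        simp [SimpleGraph.mulCayley_adj', mul_assoc] }
  -- Left multiplication respects the edges {x, x s}; transported along e, it gives a regular action
  -- of G on the graph.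
  let F : G → (NC9 l ≃g NC9 l) := fun g => (e.trans (L g)).trans e.symm
  have hF : ∀ g v, F g v = e.symm (g * e v) := fun _ _ => rfl
  have hreg : ∀ u v, ∃ g, F g u = v := fun u v => ⟨e v * (e u)⁻¹, by simp [hF]⟩
  have hfix : ∀ g v, F g v = v → g = 1 := by
    intro g v h
    rw [hF, RelIso.symm_apply_eq] at h
    simpa using h
  have hsq : ∀ g, F g * F g = F (g * g) := by
    intro g
    refine RelIso.ext fun v => ?_
    simp [RelIso.mul_apply, hF, mul_assoc]
  have h1 : F 1 = 1 := RelIso.ext fun v => by simp [hF]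
  obtain ⟨g, hg⟩ := hreg (Sum.inl 1) (twist hl (Sum.inl 1))
  have hstab := eq_one_or_eq_twist_sq hl hp hp3 ((F g)⁻¹ * twist hl)
    (by rw [RelIso.mul_apply, ← hg, RelIso.inv_apply_self])
  -- By the stabilizer of the base vertex, `F g` is `twist` or its inverse; since `twist` has
  -- trivial fourth power, the square is the same in both cases.
  have hgg : F g * F g = twist hl ^ 2 := by
    rcases hstab with h | h
    · rw [← inv_mul_eq_one.1 h, pow_two]
    · have hinv : F g = (twist hl)⁻¹ := by
        rw [inv_mul_eq_iff_eq_mul, pow_two, ← mul_assoc] at h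
        exact eq_inv_of_mul_eq_one_left (mul_eq_right.1 h.symm)
      rw [hinv, ← mul_inv_rev, ← pow_two, inv_eq_iff_mul_eq_one, ← pow_add, twist_pow_four]
  have hg1 : g * g = 1 := hfix _ (Sum.inl 1) (by rw [← hsq, hgg, twist_sq_base])
  refine twist_sq_ne_one hl hp ?_
  rw [← hgg, hsq, hg1, h1]

end Twist

/-! ### The automorphism group as a semidirect product -/

/-- The homomorphism from `ℤ₄` which maps the generator to a given element with trivial fourth
power. -/
def zmodFourHom {G : Type*} [Group G] (g : G) (hg : g ^ 4 = 1) : Multiplicative (ZMod 4) →* G where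
  toFun k := g ^ k.toAdd.val
  map_one' := by simp
  map_mul' j k := by
    rw [toAdd_mul, ZMod.val_add, ← pow_eq_pow_mod _ hg, pow_add]

section Aut

variable [Fact p.Prime] {l : (ZMod p)ˣ} (hl : (l * l : ZMod p) = -1)

/-- The action of `ℤ₄` on `H` generated by `twistAut`. -/
def twistHom : Multiplicative (ZMod 4) →* MulAut (GroupH p) :=
  zmodFourHom (twistAut l) (twistAut_pow_four hl)

/-- The homomorphism from the semidirect product into the automorphism group of `NC9`. -/
def toAut : GroupH p ⋊[twistHom hl] Multiplicative (ZMod 4) →* (NC9 l ≃g NC9 l) :=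
  SemidirectProduct.lift (rightMul l) (zmodFourHom (twist hl) (twist_pow_four hl)) (by
    intro k
    refine MonoidHom.ext fun g => ?_
    change rightMul l ((twistAut l ^ k.toAdd.val) g) =
      twist hl ^ k.toAdd.val * rightMul l g * (twist hl ^ k.toAdd.val)⁻¹
    rw [twist_pow_mul_rightMul, mul_inv_cancel_right])

theorem toAut_apply (x : GroupH p ⋊[twistHom hl] Multiplicative (ZMod 4)) :
    toAut hl x = rightMul l x.left * twist hl ^ x.right.toAdd.val := rfl

theorem toAut_surjective (hp : p ≠ 2) (hp3 : p ≠ 3) : Function.Surjective (toAut hl) := by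
  intro f
  obtain ⟨g, n, hg, -⟩ := exists_map_base_eq hl (f (Sum.inl 1))
  have key : ∃ (g : GroupH p) (n : ℕ), f = rightMul l g * twist hl ^ n := by
    rcases eq_one_or_eq_twist_sq hl hp hp3 ((rightMul l g * twist hl ^ n)⁻¹ * f)
      (by rw [RelIso.mul_apply, ← hg, RelIso.inv_apply_self]) with h | h
    · exact ⟨g, n, (inv_mul_eq_one.1 h).symm⟩
    · exact ⟨g, n + 2, by rw [pow_add, ← mul_assoc, ← h, mul_inv_cancel_left]⟩
  obtain ⟨g, n, rfl⟩ := key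
  refine ⟨⟨g, ofAdd (n : ZMod 4)⟩, ?_⟩
  rw [toAut_apply, toAdd_ofAdd, ZMod.val_natCast, ← pow_eq_pow_mod _ (twist_pow_four hl)]

/-- Odd powers of `twist` exchange the copies of `H`, so k is even. Even powers fix the base vertex,
which forces g = 1; then k = 2 is excluded because `twist`² is nontrivial. -/
theorem toAut_injective (hp : p ≠ 2) : Function.Injective (toAut hl) := by
  rw [injective_iff_map_eq_one]
  rintro ⟨g, k⟩ h
  rw [toAut_apply] at h
  have hb := DFunLike.congr_fun h (Sum.inl 1)
  rw [RelIso.mul_apply, RelIso.one_apply] at hb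
  obtain ⟨k, rfl⟩ := ofAdd.surjective k
  simp only [toAdd_ofAdd] at h hb
  have hg : (twist hl ^ k.val) (Sum.inl 1) = Sum.inl 1 → g = 1 := by
    intro ht
    rw [ht, rightMul_inl] at hb
    simpa using hb
  have h1 : (twist hl) (Sum.inl 1) = Sum.inr 1 := by simp [twist_inl]
  have h3 : (twist hl ^ 3) (Sum.inl 1) = Sum.inr 1 := by
    rw [pow_succ', RelIso.mul_apply, twist_sq_base, h1]
  have hk : k = 0 ∨ k = 1 ∨ k = 2 ∨ k = 3 := by
    clear h hb hg
    revert k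
    decide
  rcases hk with rfl | rfl | rfl | rfl
  · rw [hg (by simp)]
    rfl
  · change rightMul l g ((twist hl ^ 1) (Sum.inl 1)) = Sum.inl 1 at hb
    rw [pow_one, h1] at hb
    cases hb
  · have hg1 := hg (twist_sq_base hl)
    rw [hg1, map_one, one_mul] at h
    exact absurd h (twist_sq_ne_one hl hp)
  · change rightMul l g ((twist hl ^ 3) (Sum.inl 1)) = Sum.inl 1 at hb
    rw [h3] at hb
    cases hb

end Aut

/-! ### Elements of order four and the number of vertices -/

theorem exists_orderOf_eq_four [Fact p.Prime] (hp4 : p % 4 = 1) :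
    ∃ l : (ZMod p)ˣ, orderOf l = 4 := by
  obtain ⟨g, hg⟩ := IsCyclic.exists_ofOrder_eq_natCard (α := (ZMod p)ˣ)
  rw [Nat.card_eq_fintype_card, ZMod.card_units] at hg
  have hp2 := (Fact.out : p.Prime).two_le
  refine ⟨g ^ ((p - 1) / 4), ?_⟩
  rw [orderOf_pow_of_dvd (by omega) (by rw [hg]; exact Nat.div_dvd_of_dvd (by omega)), hg]
  exact Nat.div_div_self (by omega) (by omega)

theorem mul_self_eq_neg_one [Fact p.Prime] {l : (ZMod p)ˣ} (hl : orderOf l = 4) :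
    (l * l : ZMod p) = -1 := by
  have h4 : (l * l : ZMod p) * (l * l) = 1 := by
    have := congrArg Units.val (hl ▸ pow_orderOf_eq_one l : l ^ 4 = 1)
    push_cast at this
    rw [← this]
    ring
  refine (mul_self_eq_one_iff.1 h4).resolve_left fun h => ?_
  have h2 : l ^ 2 = 1 := Units.ext (by push_cast; rw [pow_two, h])
  have := orderOf_dvd_of_pow_eq_one h2
  rw [hl] at this
  omega

theorem natCard_vertices [Fact p.Prime] : Nat.card (GroupH p ⊕ GroupH p) = 12 * p := by
  rw [Nat.card_eq_fintype_card, Fintype.card_sum, Fintype.card_prod, Fintype.card_perm,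
    Fintype.card_multiplicative, ZMod.card, Fintype.card_fin]
  simp only [Nat.factorial]
  ring

end VNC

theorem theorem4p4 (p : ℕ) (hp : p.Prime) (hp4 : p % 4 = 1) :
    (∃ l : (ZMod p)ˣ, orderOf l = 4) ∧
    ∀ l : (ZMod p)ˣ, orderOf l = 4 →
      (VNC.NC9 l).Connected ∧
      VNC.IsCubic (VNC.NC9 l) ∧
      ¬ VNC.IsArcTransitive (VNC.NC9 l) ∧
      VNC.IsVNC (VNC.NC9 l) ∧
      Nat.card (VNC.GroupH p ⊕ VNC.GroupH p) = 12 * p ∧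
      ∃ φ : Multiplicative (ZMod 4) →* MulAut (VNC.GroupH p),
        φ (Multiplicative.ofAdd 1) (VNC.genA p) = VNC.genB p ∧
        φ (Multiplicative.ofAdd 1) (VNC.genB p) = VNC.genA p ∧
        φ (Multiplicative.ofAdd 1) (VNC.genC p) = VNC.powC l ∧
        Nonempty ((VNC.NC9 l ≃g VNC.NC9 l) ≃*
          VNC.GroupH p ⋊[φ] Multiplicative (ZMod 4)) := by
  have : Fact p.Prime := ⟨hp⟩
  have hp2 : p ≠ 2 := by rintro rfl; omega
  have hp3 : p ≠ 3 := by rintro rfl; omega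
  refine ⟨VNC.exists_orderOf_eq_four hp4, fun l hl4 => ?_⟩
  have hl := VNC.mul_self_eq_neg_one hl4
  have h1 : VNC.twistHom hl (Multiplicative.ofAdd 1) = VNC.twistAut l :=
    pow_one (VNC.twistAut l)
  refine ⟨VNC.connected_NC9 hp2 l, VNC.isCubic_NC9 hp2 l, VNC.not_isArcTransitive_NC9 hl hp2 hp3,
    ⟨VNC.isVertexTransitive_NC9 hl, VNC.not_isCayley_NC9 hl hp2 hp3⟩, VNC.natCard_vertices,
    VNC.twistHom hl, ?_, ?_, ?_, ⟨(MulEquiv.ofBijective (VNC.toAut hl)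
      ⟨VNC.toAut_injective hl hp2, VNC.toAut_surjective hl hp2 hp3⟩).symm⟩⟩
  · rw [h1, VNC.twistAut_genA]
  · rw [h1, VNC.twistAut_genB]
  · rw [h1, VNC.twistAut_genC]
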